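/- Let $W:\mathcal X\to\mathcal Z$ be a discrete memoryless channel with finite alphabets and output distributions $W_x$, $x\in\mathcal X$. Call $W$ \emph{trivial} if the distinct extremal points of the polytope $\operatorname{conv}\{W_x : x\in\mathcal X\}$ (i.e. the output distributions that remain after $W$ is made non-redundant by removing input symbols) have mutually disjoint supports. A \emph{commitment protocol} with $n$ uses of $W$ consists of a finite non-empty message set $\mathcal A$, independent private discrete random variables $M$ (Alice) and $N$ (Bob), a number $r$ of rounds and a schedule $0\le r_1\le\dots\le r_n\le r$. In the commit phase for a message $a\in\mathcal A$, in round $j$ Alice noiselessly sends $U_j$, a function of $(a,M,V_1,\dots,V_{j-1})$, and Bob noiselessly answers $V_j$, a function of $(N,U_1,\dots,U_j)$ and of the channel outputs received so far. After round $r_i$ and before round $r_i+1$ Alice sends a symbol $X_i$, a function of $(a,M,V_1,\dots,V_{r_i})$, through $W$, and Bob receives $Z_i$. In the reveal phase Alice announces $a$ and $M$ and Bob accepts or rejects by a test $\beta(Z^n,N,U^r;a,M)$. For a given constant $B\ge 0$ it is required that the range of $U^r$ has at most $2^{Bn}$ elements. The protocol is \emph{$\epsilon$-concealing} if, for any two messages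 $a,a'$ and any (possibly randomized) behaviour of Bob in the commit phase, with $N$ now denoting the randomness he uses, the distributions of $(Z^n,N,U^r)$ that arise from an honest Alice with $a$ and with $a'$ have total variation distance at most $\epsilon$. It is \emph{$\delta$-binding} if (i) with both parties honest, Bob accepts with probability at least $1-\delta$, for every $a\in\mathcal A$; and (ii) with Bob honest and for any behaviour of Alice in the commit phase, governed by a random variable $S$, and any pairs $(A,\widetilde M)$, $(A',\widetilde M')$ that are functions of $(S,V^r)$ with $A\ne A'$ almost surely, the probability that Bob's test accepts both pairs is at most $\delta$. A rate $R$ is \emph{achievable} if there are commitment protocols for every $n$, with message sets $\mathcal A_n$ such that $\frac1n\log_2|\mathcal A_n|\to R$, that are $\epsilon_n$-concealing and $\delta_n$-binding with $\epsilon_n,\delta_n\to0$. The \emph{commitment capacity} $C_{\rm com}(W)$ is the supremum of all achievable rates. Then every non-trivial discrete memoryless channel can be used to perform bit commitment: if $W$ is not trivial, then $C_{\rm com}(W)>0$, for every value of the constant $B\ge 0$. -/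

import Mathlib

open Filter Topology

noncomputable section

namespace BitCommitment

/-! ### Discrete memoryless channels

A channel with input alphabet `X` and output alphabet `Z` is a map `W : X → PMF Z`,
where `W x` is the output distribution on input `x`. -/

/-- The output distribution on input `x`, as a point of the probability simplex in `ℝ^Z`. -/
def outputDist {X Z : Type*} (W : X → PMF Z) (x : X) : Z → ℝ :=
  fun z => (W x z).toReal

/-- The polytope spanned by the output distributions of the channel. -/
def outputPolytope {X Z : Type*} (W : X → PMF Z) : Set (Z → ℝ) :=
  convexHull ℝ (Set.range (outputDist W))

/-- `W` is trivial if the distinct extremal output distributions (the output distributions of the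
non-redundant channel obtained from `W` by removing input symbols) have mutually disjoint
supports. -/
def IsTrivial {X Z : Type*} (W : X → PMF Z) : Prop :=
  ∀ p ∈ (outputPolytope W).extremePoints ℝ, ∀ q ∈ (outputPolytope W).extremePoints ℝ,
    p ≠ q → Disjoint (Function.support p) (Function.support q)

/-- The joint law of the first `k` outputs when the channel is used `n` times in sequence and the
`i`-th input is `x i` applied to the previous outputs (the dependence on the previous outputs comes
from what Bob tells Alice between the uses). -/
def channelOutputs {X Z : Type*} (W : X → PMF Z) {n : ℕ} (x : (i : Fin n) → (Fin i → Z) → X) :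
    (k : ℕ) → k ≤ n → PMF (Fin k → Z)
  | 0, _ => PMF.pure Fin.elim0
  | k + 1, h => (channelOutputs W x k (Nat.le_of_succ_le h)).bind fun z =>
      (W (x ⟨k, h⟩ z)).map fun z' => Fin.snoc (α := fun _ => Z) z z'

/-! ### The commit phase -/

/-- A deterministic behaviour of Alice in the commit phase. `send v` is the noiseless message sent
in round `v.length + 1` after receiving the list `v` of Bob's messages; `input i v` is the `i`-th
channel input, given the list `v` of Bob's messages received before that channel use. -/
structure AliceStrategy (X U V : Type*) (n : ℕ) where
  send : List V → U
  input : Fin n → List V → X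

/-- A deterministic behaviour of Bob in the commit phase: his message in round `u.length`, given the
list of channel outputs received so far and the list `u` of Alice's messages, including the one of
the current round. -/
abbrev BobStrategy (Z U V : Type*) := List Z → List U → V

/-- The number of channel uses that precede round `j` (rounds are numbered from `1`), when the
`i`-th channel use takes place after round `sched i` and before round `sched i + 1`. -/
def usesBefore {n : ℕ} (sched : Fin n → ℕ) (j : ℕ) : ℕ :=
  (Finset.univ.filter fun i => sched i < j).card

/-- The lists of Alice's and of Bob's noiseless messages in the first `j` rounds, when `z` is the
list of channel outputs. -/
def transcript {X Z U V : Type*} {n : ℕ} (sched : Fin n → ℕ) (alice : AliceStrategy X U V n)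
    (bob : BobStrategy Z U V) (z : List Z) : ℕ → List U × List V
  | 0 => ([], [])
  | j + 1 =>
      let t := transcript sched alice bob z j
      let u := t.1 ++ [alice.send t.2]
      (u, t.2 ++ [bob (z.take (usesBefore sched (j + 1))) u])

/-- The law of `(Zⁿ, Uʳ, Vʳ)` after a commit phase with `r` rounds, for deterministic strategies. -/
def run {X Z U V : Type*} (W : X → PMF Z) {n : ℕ} (r : ℕ) (sched : Fin n → ℕ)
    (alice : AliceStrategy X U V n) (bob : BobStrategy Z U V) :
    PMF ((Fin n → Z) × List U × List V) :=
  (channelOutputs W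
      (fun i z => alice.input i (transcript sched alice bob (List.ofFn z) (sched i)).2)
      n le_rfl).map
    fun z => (z, transcript sched alice bob (List.ofFn z) r)

/-- The outcome of a commit phase: Alice's and Bob's private randomness, the channel outputs, and
the noiseless messages. -/
structure Outcome (Z U V S N : Type*) (n : ℕ) where
  aliceRand : S
  bobRand : N
  outputs : Fin n → Z
  aliceMsgs : List U
  bobMsgs : List V

/-- The law of the outcome of a commit phase for randomized strategies, where Alice and Bob use
independent private random variables with laws `pS` and `pN`. -/
def execution {X Z U V S N : Type*} (W : X → PMF Z) {n : ℕ} (r : ℕ) (sched : Fin n → ℕ)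
    (pS : PMF S) (alice : S → AliceStrategy X U V n) (pN : PMF N) (bob : N → BobStrategy Z U V) :
    PMF (Outcome Z U V S N n) :=
  pS.bind fun s => pN.bind fun ν =>
    (run W r sched (alice s) (bob ν)).map fun t => ⟨s, ν, t.1, t.2.1, t.2.2⟩

/-! ### Commitment protocols -/

/-- A commitment protocol with `n` uses of a channel with input alphabet `X` and output
alphabet `Z`. -/
structure Protocol (X Z : Type*) (n : ℕ) where
  /-- The set of messages to which Alice can commit. -/
  Msg : Type
  [finite_msg : Finite Msg]
  [nonempty_msg : Nonempty Msg]
  /-- The values and the law of Alice's private random variable. -/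
  M : Type
  lawM : PMF M
  /-- The values and the law of Bob's private random variable. -/
  N : Type
  lawN : PMF N
  /-- The noiseless messages of Alice and of Bob. -/
  U : Type
  V : Type
  /-- The number of rounds of noiseless communication. -/
  r : ℕ
  /-- The `i`-th channel use takes place after round `sched i`. -/
  sched : Fin n → ℕ
  sched_mono : Monotone sched
  sched_le : ∀ i, sched i ≤ r
  /-- The honest strategies. -/
  alice : Msg → M → AliceStrategy X U V n
  bob : N → BobStrategy Z U V
  /-- Bob's test on the channel outputs, his randomness, Alice's noiseless messages, and the
  revealed message and randomness; `true` means that he accepts. -/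
  test : (Fin n → Z) → N → List U → Msg → M → Bool

/-- The probability of an event. -/
def prob {Ω : Type*} (p : PMF Ω) (E : Set Ω) : ℝ := (p.toOuterMeasure E).toReal

/-- The total variation distance, that is, half the `ℓ¹` distance. -/
def tvDist {Ω : Type*} (p q : PMF Ω) : ℝ := (1 / 2) * ∑' ω, |(p ω).toReal - (q ω).toReal|

namespace Protocol

variable {X Z : Type*} {n : ℕ}

/-- The range of `Uʳ`: all sequences of noiseless messages that an honest Alice may send,
whatever Bob does and whatever he receives. -/
def messageRange (P : Protocol X Z n) : Set (List P.U) :=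
  {u | ∃ (a : P.Msg) (m : P.M) (bob : BobStrategy Z P.U P.V) (z : Fin n → Z),
    u = (transcript P.sched (P.alice a m) bob (List.ofFn z) P.r).1}

/-- The range of `Uʳ` has at most `2 ^ (B n)` elements. -/
def MessageBound (P : Protocol X Z n) (B : ℝ) : Prop :=
  P.messageRange.Finite ∧ (P.messageRange.ncard : ℝ) ≤ (2 : ℝ) ^ (B * n)

/-- The law of Bob's view `(Zⁿ, N, Uʳ)` after the commit phase, when Alice is honest and commits
to `a`, and Bob uses the (possibly dishonest) strategy `bob` with randomness of law `pN`. -/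
def view (P : Protocol X Z n) (W : X → PMF Z) {N' : Type} (pN : PMF N')
    (bob : N' → BobStrategy Z P.U P.V) (a : P.Msg) : PMF ((Fin n → Z) × N' × List P.U) :=
  (execution W P.r P.sched P.lawM (P.alice a) pN bob).map
    fun ω => (ω.outputs, ω.bobRand, ω.aliceMsgs)

/-- `ε`-concealing: against every behaviour of Bob, the views for two messages are `ε`-close. -/
def Concealing (P : Protocol X Z n) (W : X → PMF Z) (ε : ℝ) : Prop :=
  ∀ (a a' : P.Msg) (N' : Type) (pN : PMF N') (bob : N' → BobStrategy Z P.U P.V),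
    tvDist (P.view W pN bob a) (P.view W pN bob a') ≤ ε

/-- Bob's test, when `a` and `m` are revealed after the outcome `ω` of the commit phase. -/
def Accepts (P : Protocol X Z n) {S : Type} (ω : Outcome Z P.U P.V S P.N n)
    (a : P.Msg) (m : P.M) : Prop :=
  P.test ω.outputs ω.bobRand ω.aliceMsgs a m = true

/-- `δ`-soundness: if both parties are honest, then Bob accepts with probability at least
`1 - δ`. -/
def Sound (P : Protocol X Z n) (W : X → PMF Z) (δ : ℝ) : Prop :=
  ∀ a : P.Msg, 1 - δ ≤
    prob (execution W P.r P.sched P.lawM (P.alice a) P.lawN P.bob)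
      {ω | P.Accepts ω a ω.aliceRand}

/-- Whatever Alice does in the commit phase, governed by a random variable with law `pS`, and
however she then chooses two pairs `(a, m)`, `(a', m')` with almost surely different messages as
functions of that variable and of Bob's messages, Bob accepts both of them with probability at
most `δ`. -/
def Unforgeable (P : Protocol X Z n) (W : X → PMF Z) (δ : ℝ) : Prop :=
  ∀ (S : Type) (pS : PMF S) (alice : S → AliceStrategy X P.U P.V n)
    (a a' : S → List P.V → P.Msg) (m m' : S → List P.V → P.M),
    prob (execution W P.r P.sched pS alice P.lawN P.bob)
      {ω | a ω.aliceRand ω.bobMsgs ≠ a' ω.aliceRand ω.bobMsgs} = 1 →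
    prob (execution W P.r P.sched pS alice P.lawN P.bob)
      {ω | P.Accepts ω (a ω.aliceRand ω.bobMsgs) (m ω.aliceRand ω.bobMsgs) ∧
        P.Accepts ω (a' ω.aliceRand ω.bobMsgs) (m' ω.aliceRand ω.bobMsgs)} ≤ δ

/-- `δ`-sound and `δ`-binding. -/
def Binding (P : Protocol X Z n) (W : X → PMF Z) (δ : ℝ) : Prop :=
  P.Sound W δ ∧ P.Unforgeable W δ

/-- The commitment rate, in bits per channel use. -/
def rate (P : Protocol X Z n) : ℝ := Real.logb 2 (Nat.card P.Msg) / n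

end Protocol

/-- The rate `R` is achievable, under the bound `2 ^ (B n)` on the size of the range of Alice's
noiseless messages. -/
def Achievable {X Z : Type*} (W : X → PMF Z) (B R : ℝ) : Prop :=
  ∃ (P : (n : ℕ) → Protocol X Z n) (ε δ : ℕ → ℝ),
    (∀ n, (P n).MessageBound B ∧ (P n).Concealing W (ε n) ∧ (P n).Binding W (δ n)) ∧
    Tendsto (fun n => (P n).rate) atTop (𝓝 R) ∧
    Tendsto ε atTop (𝓝 0) ∧ Tendsto δ atTop (𝓝 0)

/-- The commitment capacity: the supremum (in the extended reals) of all achievable rates. -/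
def commitmentCapacity {X Z : Type*} (W : X → PMF Z) (B : ℝ) : EReal :=
  sSup ((fun R : ℝ => (R : EReal)) '' {R | Achievable W B R})

end BitCommitment

end

noncomputable section

namespace BitCommitment

/-! ### Elementary facts on discrete distributions -/

/-! Non-triviality gives two inputs whose output distributions are distinct extreme points and share
an output letter. A binary code over these two inputs, indexed by a message `a` and private
randomness `m`, already yields commitment: Alice sends the codeword of `(a, m)` and nothing else.
With no noiseless messages, `B` imposes no constraint.

Binding comes from extremality. Each of the two distributions is exposed by a bounded function with
mean zero under it and mean at most `-c` under every different output distribution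
(`exists_exposing_function`). Bob sums these functions along the revealed codeword and applies a
threshold. If codewords of different messages are at distance at least `σ n`, any word that Alice
actually sends disagrees with one of the two revealed codewords in at least `σ n / 2` places, and a
Chernoff bound makes acceptance of that one exponentially unlikely (`codeProtocol_binding`).

Concealing comes from the common letter. For a random code with `2 ^ kM` words per message, the
expected chi-square distance from the output law of a message to the product law `mixture` is at
most `2 ^ (-kM) * spread ^ n`. The shared letter forces `spread < 2` (`spread_lt_two`), so `kM` may
stay below `n` by a small linear amount. That slack leaves room both for positive rate and for
linear distance. A random affine code over `ZMod 2` achieves both requirements with one seed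
(`exists_code`). -/

lemma prob_le_one {Ω : Type*} (p : PMF Ω) (E : Set Ω) : prob p E ≤ 1 := by
  have h : p.toOuterMeasure E ≤ 1 := by
    rw [PMF.toOuterMeasure_apply, ← p.tsum_coe]
    exact ENNReal.tsum_le_tsum fun ω => Set.indicator_le_self _ _ ω
  exact ENNReal.toReal_le_of_le_ofReal zero_le_one (by simpa using h)

lemma prob_nonneg {Ω : Type*} (p : PMF Ω) (E : Set Ω) : 0 ≤ prob p E := ENNReal.toReal_nonneg

lemma prob_mono {Ω : Type*} (p : PMF Ω) {E F : Set Ω} (h : E ⊆ F) : prob p E ≤ prob p F := by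
  refine ENNReal.toReal_mono ?_ (p.toOuterMeasure.mono h)
  refine ne_top_of_le_ne_top ENNReal.one_ne_top ?_
  rw [PMF.toOuterMeasure_apply, ← p.tsum_coe]
  exact ENNReal.tsum_le_tsum fun ω => Set.indicator_le_self _ _ ω

lemma prob_add_compl {Ω : Type*} (p : PMF Ω) (E : Set Ω) : prob p E + prob p Eᶜ = 1 := by
  have h : p.toOuterMeasure E + p.toOuterMeasure Eᶜ = 1 := by
    rw [PMF.toOuterMeasure_apply, PMF.toOuterMeasure_apply, ← ENNReal.tsum_add, ← p.tsum_coe]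
    exact tsum_congr fun ω => by
      rw [← Pi.add_apply, Set.indicator_self_add_compl]
  have h1 : p.toOuterMeasure E ≠ ⊤ := fun h' => by simp [h'] at h
  have h2 : p.toOuterMeasure Eᶜ ≠ ⊤ := fun h' => by simp [h'] at h
  rw [prob, prob, ← ENNReal.toReal_add h1 h2, h, ENNReal.toReal_one]

lemma prob_map {Ω Ω' : Type*} (p : PMF Ω) (f : Ω → Ω') (E : Set Ω') :
    prob (p.map f) E = prob p (f ⁻¹' E) := by
  rw [prob, PMF.toOuterMeasure_map_apply, prob]

lemma prob_bind_le {Ω Ω' : Type*} (p : PMF Ω) (κ : Ω → PMF Ω') (E : Set Ω') {δ : ℝ}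
    (h : ∀ ω ∈ p.support, prob (κ ω) E ≤ δ) : prob (p.bind κ) E ≤ δ := by
  obtain ⟨ω₀, hω₀⟩ := p.support_nonempty
  have hδ : 0 ≤ δ := (prob_nonneg _ _).trans (h ω₀ hω₀)
  refine ENNReal.toReal_le_of_le_ofReal hδ ?_
  rw [PMF.toOuterMeasure_bind_apply]
  calc ∑' ω, p ω * (κ ω).toOuterMeasure E
      ≤ ∑' ω, p ω * ENNReal.ofReal δ := by
        refine ENNReal.tsum_le_tsum fun ω => ?_
        by_cases hω : p ω = 0
        · simp [hω]
        gcongr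
        refine (ENNReal.le_ofReal_iff_toReal_le ?_ hδ).2 (h ω ((p.mem_support_iff ω).2 hω))
        refine ne_top_of_le_ne_top ENNReal.one_ne_top ?_
        rw [PMF.toOuterMeasure_apply, ← (κ ω).tsum_coe]
        exact ENNReal.tsum_le_tsum fun ω => Set.indicator_le_self _ _ ω
    _ = ENNReal.ofReal δ := by rw [ENNReal.tsum_mul_right, p.tsum_coe, one_mul]

lemma support_subset_of_prob_eq_one {Ω : Type*} (p : PMF Ω) {E : Set Ω} (h : prob p E = 1) :
    p.support ⊆ E := by
  rw [← PMF.toOuterMeasure_apply_eq_one_iff]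
  rwa [prob, ENNReal.toReal_eq_one_iff] at h

lemma sum_toReal {Ω : Type*} [Fintype Ω] (p : PMF Ω) : ∑ ω, (p ω).toReal = 1 := by
  rw [← ENNReal.toReal_sum fun ω _ => p.apply_ne_top ω, ← tsum_fintype (L := .unconditional _),
    p.tsum_coe, ENNReal.toReal_one]

lemma prob_eq_sum {Ω : Type*} [Fintype Ω] (p : PMF Ω) (E : Set Ω) [DecidablePred (· ∈ E)] :
    prob p E = ∑ ω, if ω ∈ E then (p ω).toReal else 0 := by
  classical
  rw [prob, PMF.toOuterMeasure_apply_fintype, ENNReal.toReal_sum]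
  · refine Finset.sum_congr rfl fun ω _ => ?_
    by_cases h : ω ∈ E <;> simp [h]
  · intro ω _
    by_cases h : ω ∈ E <;> simp [h, p.apply_ne_top]

lemma summable_toReal {Ω : Type*} (p : PMF Ω) : Summable fun ω => (p ω).toReal :=
  ENNReal.summable_toReal (by simp [p.tsum_coe])

lemma tsum_toReal {Ω : Type*} (p : PMF Ω) : ∑' ω, (p ω).toReal = 1 := by
  rw [← ENNReal.tsum_toReal_eq fun ω => p.apply_ne_top ω, p.tsum_coe, ENNReal.toReal_one]

lemma bind_apply_toReal {Ω Ω' : Type*} [Fintype Ω] (p : PMF Ω) (κ : Ω → PMF Ω') (y : Ω') :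
    (p.bind κ y).toReal = ∑ ω, (p ω).toReal * (κ ω y).toReal := by
  rw [PMF.bind_apply, tsum_fintype, ENNReal.toReal_sum]
  · simp
  · exact fun ω _ => ENNReal.mul_ne_top (p.apply_ne_top ω) ((κ ω).apply_ne_top y)

/-- Data processing. It reduces a cheating Bob to the law of the channel outputs, since all else in
his view is produced from them by a kernel that does not depend on the message. -/
lemma tvDist_bind_le {Ω Ω' : Type*} [Fintype Ω] (p q : PMF Ω) (κ : Ω → PMF Ω') :
    tvDist (p.bind κ) (q.bind κ) ≤ tvDist p q := by
  unfold tvDist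
  gcongr
  have hsum : ∀ ω ∈ (Finset.univ : Finset Ω),
      Summable fun y => |(p ω).toReal - (q ω).toReal| * (κ ω y).toReal :=
    fun ω _ => (summable_toReal (κ ω)).mul_left _
  have hle : ∀ y, |(p.bind κ y).toReal - (q.bind κ y).toReal| ≤
      ∑ ω, |(p ω).toReal - (q ω).toReal| * (κ ω y).toReal := by
    intro y
    rw [bind_apply_toReal, bind_apply_toReal, ← Finset.sum_sub_distrib]
    refine (Finset.abs_sum_le_sum_abs _ _).trans (Finset.sum_le_sum fun ω _ => ?_)
    rw [← sub_mul, abs_mul, abs_of_nonneg (ENNReal.toReal_nonneg (a := κ ω y))]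
  have hs := summable_sum hsum
  calc ∑' y, |(p.bind κ y).toReal - (q.bind κ y).toReal|
      ≤ ∑' y, ∑ ω, |(p ω).toReal - (q ω).toReal| * (κ ω y).toReal :=
        Summable.tsum_le_tsum hle
          (Summable.of_nonneg_of_le (fun _ => abs_nonneg _) hle hs) hs
    _ = ∑ ω, |(p ω).toReal - (q ω).toReal| := by
        rw [Summable.tsum_finsetSum hsum]
        simp [tsum_mul_left, tsum_toReal]
    _ = _ := (tsum_fintype _).symm

lemma tvDist_self {Ω : Type*} (p : PMF Ω) : tvDist p p = 0 := by simp [tvDist]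

/-! ### Non-adaptive use of a channel -/

lemma channelOutputs_apply {X Z : Type*} (W : X → PMF Z) {n : ℕ} (x : Fin n → X) (k : ℕ)
    (hk : k ≤ n) (z : Fin k → Z) :
    channelOutputs W (fun i _ => x i) k hk z = ∏ i, W (x (Fin.castLE hk i)) (z i) := by
  classical
  induction k with
  | zero => simp [channelOutputs, Subsingleton.elim z Fin.elim0]
  | succ k ih =>
    have hz : ∀ (y : Fin k → Z) (z' : Z),
        z = Fin.snoc (α := fun _ => Z) y z' ↔ y = Fin.init z ∧ z' = z (Fin.last k) := by
      intro y z'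
      constructor
      · rintro rfl
        simp
      · rintro ⟨rfl, rfl⟩
        simp
    -- A word splits uniquely into its initial part and last letter, so each of the two sums has a
    -- single nonzero term.
    rw [channelOutputs, PMF.bind_apply, tsum_eq_single (Fin.init z), PMF.map_apply,
      tsum_eq_single (z (Fin.last k)), ih, Fin.prod_univ_castSucc]
    · simp [Fin.init]
      rfl
    · intro z' hz'
      rw [if_neg]
      exact fun h => hz' ((hz _ _).1 h).2
    · intro y hy
      rw [PMF.map_apply, ENNReal.tsum_eq_zero.2, mul_zero]
      intro z'
      rw [if_neg]
      exact fun h => hy ((hz _ _).1 h).1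

/-- The law of the channel outputs for the input word `x`. -/
def wordOutputs {X Z : Type*} (W : X → PMF Z) {n : ℕ} (x : Fin n → X) : PMF (Fin n → Z) :=
  channelOutputs W (fun i _ => x i) n le_rfl

lemma wordOutputs_apply_toReal {X Z : Type*} (W : X → PMF Z) {n : ℕ} (x : Fin n → X)
    (z : Fin n → Z) : (wordOutputs W x z).toReal = ∏ i, outputDist W (x i) (z i) := by
  rw [wordOutputs, channelOutputs_apply, ENNReal.toReal_prod]
  rfl

lemma sum_outputDist {X Z : Type*} [Fintype Z] (W : X → PMF Z) (x : X) :
    ∑ z, outputDist W x z = 1 := sum_toReal (W x)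

lemma outputDist_nonneg {X Z : Type*} (W : X → PMF Z) (x : X) (z : Z) : 0 ≤ outputDist W x z :=
  ENNReal.toReal_nonneg

/-! ### Protocols without noiseless communication -/

section Code

variable {X Z : Type*} {n : ℕ} {A M : Type}

/-- The protocol in which Alice sends the codeword `c a m` and there is no noiseless
communication. -/
abbrev codeProtocol [Finite A] [Nonempty A] [Fintype M] [Nonempty M] (c : A → M → Fin n → X)
    (test : (Fin n → Z) → A → M → Bool) : Protocol X Z n where
  Msg := A
  M := M
  lawM := PMF.uniformOfFintype M
  N := Unit
  lawN := PMF.pure ()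
  U := Unit
  V := Unit
  r := 0
  sched := fun _ => 0
  sched_mono := fun _ _ _ => le_rfl
  sched_le := fun _ => le_rfl
  alice := fun a m => ⟨fun _ => (), fun i _ => c a m i⟩
  bob := fun _ _ _ => ()
  test := fun z _ _ a m => test z a m

lemma run_zero {U V : Type*} (W : X → PMF Z) (alice : AliceStrategy X U V n)
    (bob : BobStrategy Z U V) :
    run W 0 (fun _ => 0) alice bob =
      (wordOutputs W fun i => alice.input i []).map fun z => (z, [], []) := rfl

variable [Finite A] [Nonempty A] [Fintype M] [Nonempty M] (c : A → M → Fin n → X)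
    (test : (Fin n → Z) → A → M → Bool)

lemma codeProtocol_messageBound {B : ℝ} (hB : 0 ≤ B) : (codeProtocol c test).MessageBound B := by
  have h : (codeProtocol c test).messageRange ⊆ {[]} := by
    rintro u ⟨a, m, bob, z, rfl⟩
    rfl
  refine ⟨(Set.finite_singleton _).subset h, ?_⟩
  have h1 := Set.ncard_le_ncard h (Set.finite_singleton _)
  rw [Set.ncard_singleton] at h1
  calc ((codeProtocol c test).messageRange.ncard : ℝ) ≤ 1 := by exact_mod_cast h1
    _ ≤ _ := Real.one_le_rpow one_le_two (by positivity)

lemma codeProtocol_rate : (codeProtocol c test).rate = Real.logb 2 (Nat.card A) / n := rfl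

lemma codeProtocol_view (W : X → PMF Z) {N' : Type} (pN : PMF N')
    (bob : N' → BobStrategy Z Unit Unit) (a : A) :
    (codeProtocol c test).view W pN bob a =
      ((PMF.uniformOfFintype M).bind fun m => wordOutputs W (c a m)).bind fun z =>
        pN.map fun ν => (z, ν, []) := by
  have h : (codeProtocol c test).view W pN bob a =
      (PMF.uniformOfFintype M).bind fun m => pN.bind fun ν =>
        (wordOutputs W (c a m)).bind fun z => PMF.pure (z, ν, []) := by
    unfold Protocol.view execution
    simp only [PMF.map_bind]
    refine congrArg _ (funext fun m => congrArg _ (funext fun ν => ?_))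
    change PMF.map _ (PMF.map _ ((wordOutputs W (c a m)).map fun z => (z, [], []))) = _
    rw [PMF.map_comp, PMF.map_comp]
    rfl
  rw [h, PMF.bind_bind]
  refine congrArg _ (funext fun m => ?_)
  rw [PMF.bind_comm]
  rfl

/-- Closeness of every message to one reference `Q` suffices: the triangle inequality costs a factor
two, which the `1 / 2` in `tvDist` absorbs. `Q` need not be given as a distribution. -/
lemma codeProtocol_concealing [Fintype Z] (W : X → PMF Z) {ε : ℝ} (Q : (Fin n → Z) → ℝ)
    (h : ∀ a, ∑ z, |(Fintype.card M : ℝ)⁻¹ * ∑ m, ∏ i, outputDist W (c a m i) (z i) - Q z| ≤ ε) :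
    (codeProtocol c test).Concealing W ε := by
  intro a a' N' pN bob
  rw [codeProtocol_view, codeProtocol_view]
  refine (tvDist_bind_le _ _ _).trans ?_
  have hm : ∀ a z, (((PMF.uniformOfFintype M).bind fun m => wordOutputs W (c a m)) z).toReal =
      (Fintype.card M : ℝ)⁻¹ * ∑ m, ∏ i, outputDist W (c a m i) (z i) := by
    intro a z
    rw [bind_apply_toReal, Finset.mul_sum]
    simp [wordOutputs_apply_toReal]
  rw [tvDist, tsum_fintype]
  simp only [hm]
  have h3 : ∀ u v w : ℝ, |u - v| ≤ |u - w| + |v - w| := fun u v w => by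
    rw [abs_sub_comm v w]; exact abs_sub_le u w v
  have := Finset.sum_le_sum fun z (_ : z ∈ Finset.univ) =>
    h3 ((Fintype.card M : ℝ)⁻¹ * ∑ m, ∏ i, outputDist W (c a m i) (z i))
      ((Fintype.card M : ℝ)⁻¹ * ∑ m, ∏ i, outputDist W (c a' m i) (z i)) (Q z)
  rw [Finset.sum_add_distrib] at this
  linarith [h a, h a']

lemma codeProtocol_sound (W : X → PMF Z) {δ : ℝ}
    (h : ∀ a m, prob (wordOutputs W (c a m)) {z | test z a m ≠ true} ≤ δ) :
    (codeProtocol c test).Sound W δ := by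
  intro a
  rw [← prob_add_compl _ {ω | (codeProtocol c test).Accepts ω a ω.aliceRand}]
  suffices prob _ {ω | (codeProtocol c test).Accepts ω a ω.aliceRand}ᶜ ≤ δ by linarith
  refine prob_bind_le _ _ _ fun m _ => prob_bind_le _ _ _ fun ν _ => ?_
  change prob (PMF.map _ (run W 0 (fun _ => 0) _ _)) _ ≤ δ
  rw [run_zero, PMF.map_comp, prob_map]
  exact h a m

/-- Without messages from Bob, the revealed pairs depend on Alice's randomness `s` alone.
Conditioning on `s` leaves a fixed input word and two fixed pairs, and almost sure inequality
becomes inequality for each `s` in the support. -/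
lemma codeProtocol_unforgeable (W : X → PMF Z) {δ : ℝ}
    (h : ∀ (x : Fin n → X) (a a' : A) (m m' : M), a ≠ a' →
      prob (wordOutputs W x) {z | test z a m = true ∧ test z a' m' = true} ≤ δ) :
    (codeProtocol c test).Unforgeable W δ := by
  intro S pS alice a a' m m' hne
  have hne' : ∀ s ∈ pS.support, a s [] ≠ a' s [] := by
    intro s hs
    obtain ⟨z, hz⟩ := (wordOutputs W fun i => (alice s).input i []).support_nonempty
    refine support_subset_of_prob_eq_one _ hne (a := ⟨s, (), z, [], []⟩) ?_
    refine (PMF.mem_support_bind_iff _ _ _).2 ⟨s, hs, (PMF.mem_support_bind_iff _ _ _).2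
      ⟨(), (PMF.mem_support_pure_iff _ _).2 rfl, ?_⟩⟩
    exact (PMF.mem_support_map_iff _ _ _).2 ⟨(z, [], []),
      (PMF.mem_support_map_iff _ _ _).2 ⟨z, hz, rfl⟩, rfl⟩
  refine prob_bind_le _ _ _ fun s hs => prob_bind_le _ _ _ fun ν _ => ?_
  change prob (PMF.map _ (run W 0 (fun _ => 0) _ _)) _ ≤ δ
  rw [run_zero, PMF.map_comp, prob_map]
  exact h _ _ _ (m s []) (m' s []) (hne' s hs)

end Code

/-- Finitely many block lengths do not matter for achievability. -/
lemma achievable_of_eventually {X Z : Type*} [Nonempty X] (W : X → PMF Z) {B R : ℝ} (hB : 0 ≤ B)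
    (k : ℕ → ℝ) (ε δ : ℕ → ℝ)
    (h : ∀ᶠ n in atTop, ∃ P : Protocol X Z n, P.MessageBound B ∧ P.Concealing W (ε n) ∧
      P.Binding W (δ n) ∧ P.rate = k n)
    (hk : Tendsto k atTop (𝓝 R)) (hε : Tendsto ε atTop (𝓝 0)) (hδ : Tendsto δ atTop (𝓝 0)) :
    Achievable W B R := by
  classical
  obtain ⟨n₀, hn₀⟩ := eventually_atTop.1 h
  have key : ∀ n, ∃ P : Protocol X Z n, P.MessageBound B ∧
      P.Concealing W (if n₀ ≤ n then ε n else 0) ∧ P.Binding W (if n₀ ≤ n then δ n else 1) ∧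
      (n₀ ≤ n → P.rate = k n) := by
    intro n
    by_cases hn : n₀ ≤ n
    · obtain ⟨P, h1, h2, h3, h4⟩ := hn₀ n hn
      exact ⟨P, h1, by simpa [hn] using h2, by simpa [hn] using h3, fun _ => h4⟩
    -- Filler for small `n`: a single message is perfectly concealed, and binding with `δ = 1` is
    -- vacuous.
    · refine ⟨codeProtocol (A := Unit) (M := Unit) (fun _ _ _ => Classical.arbitrary X)
        (fun _ _ _ => true), codeProtocol_messageBound _ _ hB, ?_, ⟨?_, ?_⟩,
        fun h => absurd h hn⟩
      · intro a a' N' pN bob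
        have : a = a' := Subsingleton.elim (α := Unit) a a'
        simp [this, tvDist_self, hn]
      · intro a
        simpa [hn] using prob_nonneg _ _
      · intro S pS alice a a' m m' _
        simpa [hn] using prob_le_one _ _
  choose P h1 h2 h3 h4 using key
  have hev : ∀ᶠ n in atTop, n₀ ≤ n := eventually_ge_atTop n₀
  refine ⟨P, _, _, fun n => ⟨h1 n, h2 n, h3 n⟩, ?_, ?_, ?_⟩
  · exact hk.congr' (hev.mono fun n hn => (h4 n hn).symm)
  · exact hε.congr' (hev.mono fun n hn => by simp [hn])
  · exact hδ.congr' (hev.mono fun n hn => by simp [hn])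

/-! ### Exposing functionals and tail bounds -/

/-- An extreme point of the output polytope is exposed by a bounded centred test function. -/
lemma exists_exposing_function {X Z : Type*} [Finite X] [Fintype Z] (W : X → PMF Z) {p : Z → ℝ}
    (hp : p ∈ (outputPolytope W).extremePoints ℝ) :
    ∃ (g : Z → ℝ) (c : ℝ), 0 < c ∧ (∀ z, |g z| ≤ 1) ∧ ∑ z, p z * g z = 0 ∧
      ∀ x, outputDist W x ≠ p → ∑ z, outputDist W x z * g z ≤ -c := by
  classical
  obtain ⟨x₀, hx₀⟩ : p ∈ Set.range (outputDist W) := extremePoints_convexHull_subset hp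
  have hconv : Convex ℝ (outputPolytope W) := convex_convexHull ℝ _
  have hp' := (hconv.mem_extremePoints_iff_mem_sdiff_convexHull_sdiff.1 hp).2
  have hsub : Set.range (outputDist W) \ {p} ⊆ outputPolytope W \ {p} :=
    Set.sdiff_subset_sdiff_left (subset_convexHull ℝ _)
  -- Being extreme, `p` is outside the hull of the other output distributions. There are finitely
  -- many of these, so the hull is closed and strict separation applies.
  have hnot : p ∉ convexHull ℝ (Set.range (outputDist W) \ {p}) := fun h =>
    hp' (convexHull_mono (𝕜 := ℝ) hsub h)
  have hfin : (Set.range (outputDist W) \ {p}).Finite := (Set.finite_range _).subset Set.sdiff_subset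
  obtain ⟨f, u, hf1, hf2⟩ := geometric_hahn_banach_closed_point
    (convex_convexHull ℝ (Set.range (outputDist W) \ {p})) (hfin.isClosed_convexHull (𝕜 := ℝ)) hnot
  have hf : ∀ v : Z → ℝ, f v = ∑ z, v z * f (Pi.single z 1) := by
    intro v
    have := (f : (Z → ℝ) →ₗ[ℝ] ℝ).pi_apply_eq_sum_univ v
    simp only [ContinuousLinearMap.coe_coe, smul_eq_mul] at this
    rw [this]
    refine Finset.sum_congr rfl fun z _ => ?_
    congr 2
    ext z'
    simp [Pi.single_apply, eq_comm]
  -- Subtracting the constant `f p` centres the functional at `p`, because output distributions have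
  -- total mass one.
  set g : Z → ℝ := fun z => f (Pi.single z 1) - f p with hg
  have hmean : ∀ x, ∑ z, outputDist W x z * g z = f (outputDist W x) - f p := by
    intro x
    simp only [hg, mul_sub, Finset.sum_sub_distrib, ← Finset.sum_mul, sum_outputDist, one_mul]
    rw [← hf]
  set K : ℝ := 1 + ∑ z, |g z| with hK
  have hKpos : 0 < K := by positivity
  refine ⟨fun z => g z / K, (f p - u) / K, by have := sub_pos.2 hf2; positivity, ?_, ?_, ?_⟩
  · intro z
    rw [abs_div, abs_of_pos hKpos, div_le_one hKpos]
    have := Finset.single_le_sum (f := fun z => |g z|) (fun z _ => abs_nonneg _) (Finset.mem_univ z)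
    linarith
  · rw [← hx₀]
    simp only [mul_div_assoc', ← Finset.sum_div, hmean]
    simp [hx₀]
  · intro x hx
    simp only [mul_div_assoc', ← Finset.sum_div, hmean]
    rw [← neg_div]
    gcongr
    have := hf1 (outputDist W x) (subset_convexHull ℝ _ ⟨⟨x, rfl⟩, hx⟩)
    linarith

/-- Chernoff bound for a product distribution. -/
lemma prob_wordOutputs_sum_ge_le {X Z : Type*} [Fintype Z] (W : X → PMF Z) {n : ℕ} (x : Fin n → X)
    (g : Fin n → Z → ℝ) (hg : ∀ i z, |g i z| ≤ 1) {θ : ℝ} (h0 : 0 ≤ θ) (h1 : θ ≤ 1) (s : ℝ) :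
    prob (wordOutputs W x) {z | s ≤ ∑ i, g i (z i)} ≤
      Real.exp (-(θ * s) + θ * (∑ i, ∑ z, outputDist W (x i) z * g i z) + θ ^ 2 * n) := by
  classical
  rw [prob_eq_sum]
  have hterm : ∀ i, ∑ z, outputDist W (x i) z * Real.exp (θ * g i z) ≤
      Real.exp (θ * (∑ z, outputDist W (x i) z * g i z) + θ ^ 2) := by
    intro i
    calc ∑ z, outputDist W (x i) z * Real.exp (θ * g i z)
        ≤ ∑ z, outputDist W (x i) z * (1 + θ * g i z + θ ^ 2) := by
          refine Finset.sum_le_sum fun z _ =>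
            mul_le_mul_of_nonneg_left ?_ (outputDist_nonneg W _ z)
          -- `exp u ≤ 1 + u + u ^ 2` needs `|u| ≤ 1`; this is where `θ ≤ 1` enters.
          have ha : |θ * g i z| ≤ θ := by
            rw [abs_mul, abs_of_nonneg h0]
            exact mul_le_of_le_one_right h0 (hg i z)
          have hb := (abs_le.1 (Real.abs_exp_sub_one_sub_id_le (ha.trans h1))).2
          have hc : (θ * g i z) ^ 2 ≤ θ ^ 2 := by
            rw [← sq_abs]
            exact pow_le_pow_left₀ (abs_nonneg _) ha 2
          linarith
      _ = θ * (∑ z, outputDist W (x i) z * g i z) + θ ^ 2 + 1 := by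
          have h := sum_outputDist W (x i)
          have : ∀ z, outputDist W (x i) z * (1 + θ * g i z + θ ^ 2) =
            outputDist W (x i) z * (1 + θ ^ 2) + θ * (outputDist W (x i) z * g i z) :=
              fun z => by ring
          simp only [this, Finset.sum_add_distrib, ← Finset.sum_mul, ← Finset.mul_sum, h]
          ring
      _ ≤ _ := Real.add_one_le_exp _
  calc ∑ z : Fin n → Z, (if z ∈ {z | s ≤ ∑ i, g i (z i)} then (wordOutputs W x z).toReal else 0)
      ≤ ∑ z : Fin n → Z, Real.exp (-(θ * s)) *
          ∏ i, (outputDist W (x i) (z i) * Real.exp (θ * g i (z i))) := by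
        refine Finset.sum_le_sum fun z _ => ?_
        rw [Finset.prod_mul_distrib, ← Real.exp_sum, ← Finset.mul_sum, wordOutputs_apply_toReal]
        have hp : 0 ≤ ∏ i, outputDist W (x i) (z i) :=
          Finset.prod_nonneg fun i _ => outputDist_nonneg W _ _
        split_ifs with h
        · rw [mul_left_comm, ← Real.exp_add]
          refine le_mul_of_one_le_right hp (Real.one_le_exp ?_)
          have := mul_le_mul_of_nonneg_left (show s ≤ ∑ i, g i (z i) from h) h0
          linarith
        · positivity
    _ = Real.exp (-(θ * s)) * ∏ i, ∑ z, outputDist W (x i) z * Real.exp (θ * g i z) := by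
        rw [← Finset.mul_sum, Fintype.prod_sum]
    _ ≤ Real.exp (-(θ * s)) *
          ∏ i, Real.exp (θ * (∑ z, outputDist W (x i) z * g i z) + θ ^ 2) := by
        gcongr with i
        · intro i _
          exact Finset.sum_nonneg fun z _ => mul_nonneg (outputDist_nonneg W _ _) (Real.exp_pos _).le
        · exact hterm i
    _ = _ := by
        rw [← Real.exp_sum, ← Real.exp_add, Finset.sum_add_distrib, ← Finset.mul_sum]
        simp only [Finset.sum_const, Finset.card_univ, Fintype.card_fin, nsmul_eq_mul]
        ring_nf

/-! ### Averages over finite types -/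

/-- The average of a real function on a finite type. -/
def mean {ι : Type*} [Fintype ι] (f : ι → ℝ) : ℝ := (Fintype.card ι : ℝ)⁻¹ * ∑ i, f i

section Mean

variable {ι : Type*} [Fintype ι]

lemma mean_add (f g : ι → ℝ) : mean (fun i => f i + g i) = mean f + mean g := by
  simp [mean, Finset.sum_add_distrib, mul_add]

lemma mean_sum {σ : Type*} {s : Finset σ} (f : σ → ι → ℝ) :
    mean (fun i => ∑ k ∈ s, f k i) = ∑ k ∈ s, mean (f k) := by
  simp only [mean]
  rw [Finset.sum_comm, Finset.mul_sum]

lemma mean_const_mul (c : ℝ) (f : ι → ℝ) : mean (fun i => c * f i) = c * mean f := by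
  simp only [mean, ← Finset.mul_sum]
  ring

lemma mean_div_const (c : ℝ) (f : ι → ℝ) : mean (fun i => f i / c) = mean f / c := by
  simp only [mean, ← Finset.sum_div]
  ring

lemma mean_const [Nonempty ι] (c : ℝ) : mean (fun _ : ι => c) = c := by
  simp [mean]

lemma mean_sub_const [Nonempty ι] (f : ι → ℝ) (c : ℝ) : mean (fun i => f i - c) = mean f - c := by
  simp only [sub_eq_add_neg, mean_add, mean_const]

lemma exists_le_mean [Nonempty ι] (f : ι → ℝ) : ∃ i, f i ≤ mean f := by
  by_contra! h
  have h1 : ∑ _i : ι, mean f < ∑ i, f i :=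
    Finset.sum_lt_sum_of_nonempty Finset.univ_nonempty fun i _ => h i
  rw [Finset.sum_const, Finset.card_univ, nsmul_eq_mul, mean, mul_inv_cancel_left₀] at h1
  · exact lt_irrefl _ h1
  · exact_mod_cast Fintype.card_ne_zero

lemma mean_prod_mul {κ : Type*} [Fintype κ] (f : ι → ℝ) (g : κ → ℝ) :
    mean (fun x : ι × κ => f x.1 * g x.2) = mean f * mean g := by
  simp only [mean, Fintype.sum_prod_type, ← Finset.mul_sum, ← Finset.sum_mul, Fintype.card_prod]
  push_cast
  rw [mul_inv]
  ring

/-- A surjective homomorphism maps the uniform distribution to the uniform distribution. -/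
lemma mean_comp_of_surjective {G H : Type*} [AddGroup G] [AddGroup H] [Fintype G] [Fintype H]
    (φ : G →+ H) (hφ : Function.Surjective φ) (f : H → ℝ) : mean (fun g => f (φ g)) = mean f := by
  classical
  -- The fibres are cosets of the kernel, so all have the same size.
  have hfib : ∀ h : H, (Finset.univ.filter fun g => φ g = h).card =
      (Finset.univ.filter fun g => φ g = 0).card := fun h =>
    AddMonoidHom.card_fiber_eq_of_mem_range φ (hφ h) (hφ 0)
  set c := (Finset.univ.filter fun g => φ g = 0).card
  have hcard : Fintype.card G = Fintype.card H * c := by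
    rw [← Finset.card_univ, Finset.card_eq_sum_card_fiberwise (f := φ) (t := Finset.univ)
      (fun _ _ => Finset.mem_coe.2 (Finset.mem_univ _))]
    simp [hfib]
  have hsum : ∑ g, f (φ g) = c * ∑ h, f h := by
    rw [← Finset.sum_fiberwise Finset.univ φ, Finset.mul_sum]
    refine Finset.sum_congr rfl fun h _ => ?_
    rw [Finset.sum_congr rfl (g := fun _ => f h)
      fun g hg => by rw [(Finset.mem_filter.1 hg).2], Finset.sum_const, hfib, nsmul_eq_mul]
  have hc : (c : ℝ) ≠ 0 := by
    intro h0
    have : Fintype.card G = 0 := by rw [hcard, Nat.cast_eq_zero.1 h0, mul_zero]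
    exact Fintype.card_ne_zero this
  rw [mean, mean, hsum, hcard]
  push_cast
  rw [mul_inv, mul_assoc, inv_mul_cancel_left₀ hc]

/-- The second moment of the deviation of an empirical average over pairwise independent points. -/
lemma mean_sq_deviation_le {T M Y : Type*} [Fintype T] [Fintype M] [Nonempty M] [Fintype Y]
    [Nonempty Y] (c : T → M → Y)
    (hsingle : ∀ m (f : Y → ℝ), mean (fun t => f (c t m)) = mean f)
    (hpair : ∀ m m', m ≠ m' → ∀ f g : Y → ℝ,
      mean (fun t => f (c t m) * g (c t m')) = mean f * mean g) (f : Y → ℝ) :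
    mean (fun t => (mean (fun m => f (c t m)) - mean f) ^ 2) ≤
      (Fintype.card M : ℝ)⁻¹ * mean fun y => f y ^ 2 := by
  classical
  set h : Y → ℝ := fun y => f y - mean f with hh
  have hmean : mean h = 0 := by rw [hh, mean_sub_const, sub_self]
  have hsq : mean (fun y => h y * h y) ≤ mean fun y => f y ^ 2 := by
    have : ∀ y, h y * h y = f y ^ 2 + (-(2 * mean f) * f y + mean f ^ 2) := fun y => by
      simp only [hh]; ring
    simp only [this, mean_add, mean_const, mean_const_mul]
    nlinarith [sq_nonneg (mean f)]
  have hdev : ∀ t, (mean (fun m => f (c t m)) - mean f) ^ 2 =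
      (Fintype.card M : ℝ)⁻¹ ^ 2 * ∑ m, ∑ m', h (c t m) * h (c t m') := by
    intro t
    rw [← mean_sub_const, mean, mul_pow, sq (∑ i, _), Finset.sum_mul_sum]
  have hM : (Fintype.card M : ℝ) ≠ 0 := by exact_mod_cast Fintype.card_ne_zero
  -- After centring, pairwise independence kills the cross terms; only the `card M` diagonal ones
  -- remain.
  have hdiag : ∀ m m', mean (fun t => h (c t m) * h (c t m')) =
      if m = m' then mean (fun y => h y * h y) else 0 := by
    intro m m'
    split_ifs with hm
    · subst hm
      exact hsingle m fun y => h y * h y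
    · rw [hpair m m' hm, hmean, zero_mul]
  simp only [hdev, mean_const_mul, mean_sum, hdiag, Finset.sum_ite_eq, Finset.mem_univ, if_true,
    Finset.sum_const, Finset.card_univ, nsmul_eq_mul]
  rw [sq, mul_assoc, inv_mul_cancel_left₀ hM]
  gcongr

end Mean

/-! ### Random affine codes -/

section Affine

variable {n : ℕ} {K : Type*} [Fintype K]

/-- The word with index `w` of the affine code with seed `t`. -/
def affineWord (t : Matrix (Fin n) K (ZMod 2) × (Fin n → ZMod 2)) (w : K → ZMod 2) :
    Fin n → ZMod 2 := t.1.mulVec w + t.2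

lemma affineWord_sub (t : Matrix (Fin n) K (ZMod 2) × (Fin n → ZMod 2)) (w w' : K → ZMod 2) :
    affineWord t w - affineWord t w' = t.1.mulVec (w - w') := by
  simp [affineWord, Matrix.mulVec_sub]

variable [DecidableEq K]

lemma mulVec_surjective {w : K → ZMod 2} (hw : w ≠ 0) (y : Fin n → ZMod 2) :
    ∃ G : Matrix (Fin n) K (ZMod 2), G.mulVec w = y := by
  obtain ⟨j, hj⟩ := Function.ne_iff.1 hw
  -- A matrix supported on one column where `w` is nonzero is enough.
  refine ⟨fun i j' => if j' = j then y i * (w j)⁻¹ else 0, ?_⟩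
  ext i
  have hj' : w j ≠ 0 := hj
  simp [Matrix.mulVec, dotProduct, mul_assoc, inv_mul_cancel₀ hj']

lemma mean_mulVec {w : K → ZMod 2} (hw : w ≠ 0) (f : (Fin n → ZMod 2) → ℝ) :
    mean (fun t : Matrix (Fin n) K (ZMod 2) × (Fin n → ZMod 2) => f (t.1.mulVec w)) = mean f :=
  mean_comp_of_surjective
    ({ toFun := fun t => t.1.mulVec w
       map_zero' := by simp
       map_add' := fun s t => by simp [Matrix.add_mulVec] } :
      Matrix (Fin n) K (ZMod 2) × (Fin n → ZMod 2) →+ (Fin n → ZMod 2))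
    (fun y => by
      obtain ⟨G, hG⟩ := mulVec_surjective hw y
      exact ⟨(G, 0), hG⟩) f

lemma mean_affineWord (w : K → ZMod 2) (f : (Fin n → ZMod 2) → ℝ) :
    mean (fun t : Matrix (Fin n) K (ZMod 2) × (Fin n → ZMod 2) => f (affineWord t w)) = mean f :=
  mean_comp_of_surjective
    ({ toFun := fun t => affineWord t w
       map_zero' := by simp [affineWord]
       map_add' := fun s t => by
        simp only [affineWord, Prod.fst_add, Prod.snd_add, Matrix.add_mulVec]
        abel } :
      Matrix (Fin n) K (ZMod 2) × (Fin n → ZMod 2) →+ (Fin n → ZMod 2))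
    (fun y => ⟨(0, y), by simp [affineWord]⟩) f

/-- Pairwise independence of the codewords: `G` can be chosen to produce any prescribed difference,
and the shift then places the first word anywhere, so the seed maps onto all pairs. -/
lemma mean_affineWord_mul {w w' : K → ZMod 2} (hw : w ≠ w') (f g : (Fin n → ZMod 2) → ℝ) :
    mean (fun t : Matrix (Fin n) K (ZMod 2) × (Fin n → ZMod 2) =>
      f (affineWord t w) * g (affineWord t w')) = mean f * mean g := by
  rw [← mean_prod_mul]
  refine mean_comp_of_surjective
    ({ toFun := fun t => (affineWord t w, affineWord t w')
       map_zero' := by simp [affineWord]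
       map_add' := fun s t => by
        simp only [affineWord, Prod.fst_add, Prod.snd_add, Matrix.add_mulVec, Prod.mk_add_mk]
        congr 1 <;> abel } :
      Matrix (Fin n) K (ZMod 2) × (Fin n → ZMod 2) →+ (Fin n → ZMod 2) × (Fin n → ZMod 2))
    (fun y => ?_) fun y => f y.1 * g y.2
  obtain ⟨G, hG⟩ := mulVec_surjective (sub_ne_zero.2 hw) (y.1 - y.2)
  rw [Matrix.mulVec_sub] at hG
  refine ⟨(G, y.1 - G.mulVec w), Prod.ext ?_ ?_⟩
  · simp [affineWord]
  · have : G.mulVec w' + (y.1 - G.mulVec w) = y.1 - (G.mulVec w - G.mulVec w') := by abel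
    simp [affineWord, this, hG]

lemma sum_zmod_two (F : ZMod 2 → ℝ) : ∑ b, F b = F 0 + F 1 := Fin.sum_univ_two F

/-- The weight is a sum over coordinates, so its generating function factors. This drives the
exponential Markov bound on small distances. -/
lemma mean_pow_hammingNorm (s : ℝ) :
    mean (fun y : Fin n → ZMod 2 => s ^ hammingNorm y) = ((1 + s) / 2) ^ n := by
  have h : ∀ y : Fin n → ZMod 2, s ^ hammingNorm y = ∏ i, if y i ≠ 0 then s else 1 := by
    intro y
    rw [hammingNorm, Finset.prod_ite]
    simp
  have h2 : ∑ b : ZMod 2, (if b ≠ 0 then s else 1) = 1 + s := by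
    rw [sum_zmod_two]
    simp
  simp only [mean, h]
  rw [← Fintype.prod_sum (fun (_ : Fin n) (b : ZMod 2) => if b ≠ 0 then s else 1), h2]
  simp [div_eq_inv_mul, mul_pow]

end Affine

/-! ### Existence of good codes -/

section GoodCode

variable {Z : Type*} {n : ℕ}

lemma mean_prod (F : ZMod 2 → Z → ℝ) (z : Fin n → Z) :
    mean (fun x : Fin n → ZMod 2 => ∏ i, F (x i) (z i)) = ∏ i, (F 0 (z i) + F 1 (z i)) / 2 := by
  rw [mean, ← Fintype.prod_sum fun i b => F b (z i)]
  rw [Finset.prod_div_distrib]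
  have : ∀ i, ∑ b : ZMod 2, F b (z i) = F 0 (z i) + F 1 (z i) := fun i => sum_zmod_two _
  simp [this, div_eq_inv_mul]

/-- The product law with single-letter law the average of `p 0` and `p 1`. -/
def mixture (p : ZMod 2 → Z → ℝ) (z : Fin n → Z) : ℝ := ∏ i, (p 0 (z i) + p 1 (z i)) / 2

variable [Fintype Z]

/-- The overlap parameter of two distributions, which is `2` when the supports are disjoint. -/
def spread (p : ZMod 2 → Z → ℝ) : ℝ := ∑ z, (p 0 z ^ 2 + p 1 z ^ 2) / (p 0 z + p 1 z)

/-- Each term is `p 0 z + p 1 z` minus `2 * p 0 z * p 1 z / (p 0 z + p 1 z)`, and the loss is strict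
at the common letter. -/
lemma spread_lt_two {p : ZMod 2 → Z → ℝ} (hp : ∀ b z, 0 ≤ p b z) (hsum : ∀ b, ∑ z, p b z = 1)
    {z₀ : Z} (h0 : p 0 z₀ ≠ 0) (h1 : p 1 z₀ ≠ 0) : spread p < 2 := by
  have h2 : ∑ z, (p 0 z + p 1 z) = 2 := by
    rw [Finset.sum_add_distrib, hsum, hsum]; norm_num
  rw [← h2]
  refine Finset.sum_lt_sum (fun z _ => ?_) ⟨z₀, Finset.mem_univ _, ?_⟩
  · have := hp 0 z
    have := hp 1 z
    refine div_le_of_le_mul₀ (by positivity) (by positivity) ?_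
    nlinarith [mul_nonneg (hp 0 z) (hp 1 z)]
  · have h0' : 0 < p 0 z₀ := (hp 0 z₀).lt_of_ne' h0
    have h1' : 0 < p 1 z₀ := (hp 1 z₀).lt_of_ne' h1
    rw [div_lt_iff₀ (by positivity)]
    nlinarith [mul_pos h0' h1']

/-- First-moment method. The left side of `h` bounds the mean of a penalty adding up the low-weight
differences and the scaled chi-square distances of all messages. A seed with penalty below one keeps
every summand below one, so both properties hold for all messages at once. -/
lemma exists_code {p : ZMod 2 → Z → ℝ} (hp : ∀ b z, 0 ≤ p b z) (hsum : ∀ b, ∑ z, p b z = 1)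
    {kA kM : ℕ} {s τ η : ℝ} (hs : 0 < s) (hτ : 0 < τ) (hη : 0 < η)
    (h : (2 : ℝ) ^ (kA + kM) * ((1 + s) / 2 / τ) ^ n +
      2 ^ kA * (((2 : ℝ) ^ kM)⁻¹ * spread p ^ n) / η < 1) :
    ∃ c : (Fin kA → ZMod 2) → (Fin kM → ZMod 2) → Fin n → ZMod 2,
      (∀ a a' m m', a ≠ a' → s ^ hammingDist (c a m) (c a' m') < τ ^ n) ∧
      ∀ a, ∑ z, |mean (fun m => ∏ i, p (c a m i) (z i)) - mixture p z| ≤ √η := by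
  classical
  have hQ : ∀ z : Fin n → Z, 0 ≤ mixture p z := fun z =>
    Finset.prod_nonneg fun i _ => div_nonneg (add_nonneg (hp _ _) (hp _ _)) zero_le_two
  have hQsum : ∑ z : Fin n → Z, mixture p z = 1 := by
    simp only [mixture]
    rw [← Fintype.prod_sum fun (_ : Fin n) z => (p 0 z + p 1 z) / 2]
    simp [← Finset.sum_div, Finset.sum_add_distrib, hsum]
  -- Absolute continuity with respect to the mixture; it makes the convention `x / 0 = 0` in `χ`
  -- harmless.
  have hQzero : ∀ z : Fin n → Z, mixture p z = 0 → ∀ x : Fin n → ZMod 2,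
      ∏ i, p (x i) (z i) = 0 := by
    intro z hz x
    obtain ⟨i, _, hi⟩ := Finset.prod_eq_zero_iff.1 hz
    refine Finset.prod_eq_zero (Finset.mem_univ i) ?_
    have h0 := hp 0 (z i)
    have h1 := hp 1 (z i)
    have : ∀ b : ZMod 2, p b (z i) = 0 := by
      intro b
      fin_cases b
      · change p 0 (z i) = 0
        linarith
      · change p 1 (z i) = 0
        linarith
    exact this _
  let T := Matrix (Fin n) (Fin kA ⊕ Fin kM) (ZMod 2) × (Fin n → ZMod 2)
  let c : T → (Fin kA → ZMod 2) → (Fin kM → ZMod 2) → Fin n → ZMod 2 :=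
    fun t a m => affineWord t (Sum.elim a m)
  let P : T → (Fin kA → ZMod 2) → (Fin n → Z) → ℝ :=
    fun t a z => mean fun m => ∏ i, p (c t a m i) (z i)
  let χ : T → (Fin kA → ZMod 2) → ℝ :=
    fun t a => ∑ z, (P t a z - mixture p z) ^ 2 / mixture p z
  let low : T → ℝ := fun t =>
    ∑ w ∈ Finset.univ.filter fun w : Fin kA ⊕ Fin kM → ZMod 2 => w ≠ 0,
      s ^ hammingNorm (t.1.mulVec w) / τ ^ n
  have hχ0 : ∀ t a, 0 ≤ χ t a := fun t a =>
    Finset.sum_nonneg fun z _ => div_nonneg (sq_nonneg _) (hQ z)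
  have hlow : mean low ≤ 2 ^ (kA + kM) * ((1 + s) / 2 / τ) ^ n := by
    have hterm : ∀ w ∈ Finset.univ.filter fun w : Fin kA ⊕ Fin kM → ZMod 2 => w ≠ 0,
        mean (fun t : T => s ^ hammingNorm (t.1.mulVec w) / τ ^ n) = ((1 + s) / 2 / τ) ^ n := by
      intro w hw
      rw [mean_div_const, mean_mulVec (Finset.mem_filter.1 hw).2 fun y => s ^ hammingNorm y,
        mean_pow_hammingNorm, ← div_pow]
    rw [mean_sum, Finset.sum_congr rfl hterm, Finset.sum_const, nsmul_eq_mul]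
    gcongr
    refine (Nat.cast_le.2 (Finset.card_filter_le _ _)).trans ?_
    simp
  have hχ : ∀ a, mean (fun t => χ t a) ≤ ((2 : ℝ) ^ kM)⁻¹ * spread p ^ n := by
    intro a
    have hz : ∀ z, mean (fun t => (P t a z - mixture p z) ^ 2) ≤
        ((2 : ℝ) ^ kM)⁻¹ * ∏ i, (p 0 (z i) ^ 2 + p 1 (z i) ^ 2) / 2 := by
      intro z
      have h1 := mean_sq_deviation_le (fun (t : T) m => c t a m)
        (fun m f => mean_affineWord _ f)
        (fun m m' hm f g => mean_affineWord_mul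
          (fun h' => hm (Sum.elim_injective' h')) f g)
        fun x => ∏ i, p (x i) (z i)
      simp only [← Finset.prod_pow] at h1
      rw [mean_prod p z, mean_prod (fun b z => p b z ^ 2) z] at h1
      simpa [P, mixture] using h1
    simp only [χ]
    rw [mean_sum]
    calc ∑ z : Fin n → Z, mean (fun t => (P t a z - mixture p z) ^ 2 / mixture p z)
        ≤ ∑ z : Fin n → Z, ((2 : ℝ) ^ kM)⁻¹ *
            ∏ i, (p 0 (z i) ^ 2 + p 1 (z i) ^ 2) / (p 0 (z i) + p 1 (z i)) := by
          refine Finset.sum_le_sum fun z _ => ?_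
          rw [mean_div_const]
          refine (div_le_div_of_nonneg_right (hz z) (hQ z)).trans_eq ?_
          rw [mul_div_assoc, mixture, ← Finset.prod_div_distrib]
          congr 1
          refine Finset.prod_congr rfl fun i _ => ?_
          rw [div_div_div_cancel_right₀ two_ne_zero]
      _ = _ := by
          rw [← Finset.mul_sum, ← Fintype.prod_sum fun (_ : Fin n) z =>
            (p 0 z ^ 2 + p 1 z ^ 2) / (p 0 z + p 1 z)]
          simp [spread]
  have hmean : mean (fun t : T => low t + ∑ a, χ t a / η) < 1 := by
    refine lt_of_le_of_lt ?_ h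
    rw [mean_add low fun t => ∑ a, χ t a / η, mean_sum fun a t => χ t a / η]
    refine add_le_add hlow ?_
    calc ∑ a, mean (fun t => χ t a / η)
        ≤ ∑ _a : Fin kA → ZMod 2, ((2 : ℝ) ^ kM)⁻¹ * spread p ^ n / η := by
          refine Finset.sum_le_sum fun a _ => ?_
          rw [mean_div_const]
          exact div_le_div_of_nonneg_right (hχ a) hη.le
      _ = _ := by simp [mul_div_assoc]
  obtain ⟨t, ht⟩ := exists_le_mean (fun t : T => low t + ∑ a, χ t a / η)
  have ht1 := ht.trans_lt hmean
  have hlow0 : ∀ w : Fin kA ⊕ Fin kM → ZMod 2, 0 ≤ s ^ hammingNorm (t.1.mulVec w) / τ ^ n :=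
    fun w => by positivity
  refine ⟨c t, ?_, ?_⟩
  · intro a a' m m' ha
    have hw : Sum.elim a' m' - Sum.elim a m ≠ 0 := fun h' =>
      ha (funext fun j => by simpa using (congrFun (sub_eq_zero.1 h') (Sum.inl j)).symm)
    -- The shift cancels in the difference, so distances are weights in the linear code.
    rw [hammingDist_eq_hammingNorm, neg_add_eq_sub, affineWord_sub, ← div_lt_one (by positivity)]
    have h1 : s ^ hammingNorm (t.1.mulVec (Sum.elim a' m' - Sum.elim a m)) / τ ^ n ≤ low t :=
      Finset.single_le_sum
        (f := fun w : Fin kA ⊕ Fin kM → ZMod 2 => s ^ hammingNorm (t.1.mulVec w) / τ ^ n)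
        (fun w _ => hlow0 w) (Finset.mem_filter.2 ⟨Finset.mem_univ _, hw⟩)
    have h2 : 0 ≤ ∑ a, χ t a / η := Finset.sum_nonneg fun a _ => div_nonneg (hχ0 t a) hη.le
    linarith
  · intro a
    refine Real.le_sqrt_of_sq_le ?_
    have hχη : χ t a ≤ η := by
      have h1 : χ t a / η ≤ ∑ a, χ t a / η := Finset.single_le_sum (f := fun a => χ t a / η)
        (fun a _ => div_nonneg (hχ0 t a) hη.le) (Finset.mem_univ a)
      have h2 : 0 ≤ low t := Finset.sum_nonneg fun w _ => hlow0 w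
      exact ((div_lt_one hη).1 (by linarith)).le
    -- Cauchy–Schwarz: the squared `ℓ¹` distance is at most the mass of the mixture times the
    -- chi-square distance.
    refine (Finset.sum_sq_le_sum_mul_sum_of_sq_le_mul Finset.univ (f := mixture p)
      (g := fun z => (P t a z - mixture p z) ^ 2 / mixture p z) (fun z _ => hQ z)
      (fun z _ => div_nonneg (sq_nonneg _) (hQ z)) ?_).trans ?_
    · intro z _
      rw [sq_abs]
      by_cases hz : mixture p z = 0
      · simp [hz, hQzero z hz, mean]
      · rw [mul_div_cancel₀ _ hz]
    · rw [hQsum, one_mul]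
      exact hχη

end GoodCode

/-! ### The test of the commitment protocol -/

section Test

variable {X Z : Type*} [Fintype Z] {n : ℕ}

/-- Bob's test: the statistic of the codeword `y` is not far below its honest mean. -/
def thresholdTest (g : ZMod 2 → Z → ℝ) (s : ℝ) (y : Fin n → ZMod 2) (z : Fin n → Z) : Bool :=
  decide (-s ≤ ∑ i, g (y i) (z i))

lemma prob_threshold_reject_le (W : X → PMF Z) {e : ZMod 2 → X} {g : ZMod 2 → Z → ℝ}
    (hg : ∀ b z, |g b z| ≤ 1) (hmean : ∀ b, ∑ z, outputDist W (e b) z * g b z = 0)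
    {θ : ℝ} (h0 : 0 ≤ θ) (h1 : θ ≤ 1) (s : ℝ) (y : Fin n → ZMod 2) :
    prob (wordOutputs W fun i => e (y i)) {z | thresholdTest g s y z ≠ true} ≤
      Real.exp (-(θ * s) + θ ^ 2 * n) := by
  have h := prob_wordOutputs_sum_ge_le W (fun i => e (y i)) (fun i z => -g (y i) z)
    (fun i z => by simpa using hg (y i) z) h0 h1 s
  simp only [mul_neg, Finset.sum_neg_distrib, hmean, Finset.sum_const_zero, neg_zero, mul_zero,
    add_zero] at h
  refine (prob_mono _ fun z hz => ?_).trans h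
  simp only [thresholdTest, ne_eq, decide_eq_true_eq, not_le, Set.mem_ofPred_eq] at hz ⊢
  linarith

lemma prob_threshold_accept_le (W : X → PMF Z) {e : ZMod 2 → X} {g : ZMod 2 → Z → ℝ} {c : ℝ}
    (hg : ∀ b z, |g b z| ≤ 1) (hmean : ∀ b, ∑ z, outputDist W (e b) z * g b z = 0)
    (hgap : ∀ b x, outputDist W x ≠ outputDist W (e b) → ∑ z, outputDist W x z * g b z ≤ -c)
    {θ : ℝ} (h0 : 0 ≤ θ) (h1 : θ ≤ 1) (s : ℝ) (x : Fin n → X) (y : Fin n → ZMod 2)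
    {D : Finset (Fin n)}
    (hD : ∀ i, i ∈ D ↔ outputDist W (x i) ≠ outputDist W (e (y i))) :
    prob (wordOutputs W x) {z | thresholdTest g s y z = true} ≤
      Real.exp (θ * s - θ * (c * D.card) + θ ^ 2 * n) := by
  classical
  have h := prob_wordOutputs_sum_ge_le W x (fun i z => g (y i) z) (fun i z => hg (y i) z) h0 h1 (-s)
  have hsum : ∑ i, ∑ z, outputDist W (x i) z * g (y i) z ≤ -(c * D.card) := by
    calc ∑ i, ∑ z, outputDist W (x i) z * g (y i) z ≤ ∑ i, if i ∈ D then -c else 0 := by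
          refine Finset.sum_le_sum fun i _ => ?_
          split_ifs with hi
          · exact hgap _ _ ((hD i).1 hi)
          · rw [hD, not_not] at hi
            rw [hi, hmean]
      _ = _ := by simp [mul_comm]
  refine (prob_mono _ fun z hz => ?_).trans (h.trans (Real.exp_le_exp.2 ?_))
  · simpa [thresholdTest] using hz
  · have := mul_le_mul_of_nonneg_left hsum h0
    linarith

/-- A code with large distance between codewords of different messages is binding. -/
lemma codeProtocol_binding {A M : Type} [Finite A] [Nonempty A] [Fintype M] [Nonempty M]
    (W : X → PMF Z) {e : ZMod 2 → X} {g : ZMod 2 → Z → ℝ} {c σ : ℝ}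
    (he : outputDist W (e 0) ≠ outputDist W (e 1)) (hc : 0 < c) (hσ : 0 < σ)
    (hg : ∀ b z, |g b z| ≤ 1) (hmean : ∀ b, ∑ z, outputDist W (e b) z * g b z = 0)
    (hgap : ∀ b x, outputDist W x ≠ outputDist W (e b) → ∑ z, outputDist W x z * g b z ≤ -c)
    (y : A → M → Fin n → ZMod 2)
    (hy : ∀ a a' m m', a ≠ a' → σ * n ≤ hammingDist (y a m) (y a' m')) :
    (codeProtocol (fun a m i => e (y a m i))
      fun z a m => thresholdTest g (c * σ * n / 4) (y a m) z).Binding W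
      (Real.exp (-(min 1 (c * σ / 8) * (c * σ / 8)) * n)) := by
  classical
  -- With threshold `c σ n / 4` and a mean drop of at least `c σ n / 2`, both error exponents have
  -- margin `c σ / 4` per letter; this `θ` spends at most half of it on the quadratic term.
  set θ := min 1 (c * σ / 8) with hθ
  have h0 : 0 ≤ θ := le_min zero_le_one (by positivity)
  have h1 : θ ≤ 1 := min_le_left _ _
  have h2 : θ ^ 2 * n ≤ θ * (c * σ / 8) * n := by
    rw [sq]
    gcongr
    exact min_le_right _ _
  have he' : ∀ b b', b ≠ b' → outputDist W (e b) ≠ outputDist W (e b') := by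
    intro b b' hb
    have : ∀ b : ZMod 2, b = 0 ∨ b = 1 := by decide
    rcases this b with rfl | rfl <;> rcases this b' with rfl | rfl
    · exact absurd rfl hb
    · exact he
    · exact he.symm
    · exact absurd rfl hb
  refine ⟨codeProtocol_sound _ _ W fun a m => ?_, codeProtocol_unforgeable _ _ W ?_⟩
  · refine (prob_threshold_reject_le W hg hmean h0 h1 _ _).trans (Real.exp_le_exp.2 ?_)
    linarith
  · intro x a a' m m' ha
    let D : (Fin n → ZMod 2) → Finset (Fin n) := fun w =>
      Finset.univ.filter fun i => outputDist W (x i) ≠ outputDist W (e (w i))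
    have hacc : ∀ w, σ * n / 2 ≤ (D w).card →
        prob (wordOutputs W x) {z | thresholdTest g (c * σ * n / 4) w z = true} ≤
          Real.exp (-(θ * (c * σ / 8)) * n) := by
      intro w hw
      refine (prob_threshold_accept_le W hg hmean hgap h0 h1 _ x w (D := D w)
        (fun i => by simp [D])).trans (Real.exp_le_exp.2 ?_)
      have h3 : θ * (c * (σ * n / 2)) ≤ θ * (c * (D w).card) := by gcongr
      linarith
    -- Where the codewords differ, the two output distributions are distinct, so that of `x i`
    -- misses at least one.
    have hcard : hammingDist (y a m) (y a' m') ≤ (D (y a m)).card + (D (y a' m')).card := by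
      refine (Finset.card_le_card fun i hi => ?_).trans (Finset.card_union_le _ _)
      simp only [D, Finset.mem_filter, Finset.mem_univ, true_and, Finset.mem_union] at hi ⊢
      by_contra! h'
      exact he' _ _ hi (h'.1.symm.trans h'.2)
    have hcard' : σ * n ≤ (D (y a m)).card + (D (y a' m')).card :=
      (hy a a' m m' ha).trans (by exact_mod_cast hcard)
    rcases le_total (σ * n / 2) ((D (y a m)).card : ℝ) with h | h
    · exact (prob_mono _ fun z hz => hz.1).trans (hacc _ h)
    · exact (prob_mono _ fun z hz => hz.2).trans (hacc (y a' m') (by linarith))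

end Test

/-! ### Choice of the parameters -/

/-- With `k ≈ n log b` message bits and `n - 3 * k` random bits, the union over messages leaves a
factor `2 ^ (4 * k - n)`, about `(b ^ 4 / 2) ^ n`; hence the fourth power. -/
lemma exists_base {ρ : ℝ} (h2 : ρ < 2) : ∃ b : ℝ, 1 < b ∧ b ^ 4 < 2 ∧ b ^ 4 * ρ < 2 := by
  have h3 : Tendsto (fun b : ℝ => b ^ 4) (𝓝[>] 1) (𝓝 1) := by
    have : ContinuousAt (fun b : ℝ => b ^ 4) 1 := by fun_prop
    simpa using this.tendsto.mono_left nhdsWithin_le_nhds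
  have h4 : Tendsto (fun b : ℝ => b ^ 4 * ρ) (𝓝[>] 1) (𝓝 ρ) := by simpa using h3.mul_const ρ
  obtain ⟨b, hb1, hb2, hb3⟩ := ((h3.eventually_lt_const one_lt_two).and
    ((h4.eventually_lt_const h2).and self_mem_nhdsWithin)).exists
  exact ⟨b, hb3, hb1, hb2⟩

/-- The averaging bound of `exists_code` for message length `⌊n log b⌋`. -/
lemma averaging_bound_le {b ρ s τ : ℝ} (hb : 1 < b) (hb4 : b ^ 4 < 2) (hρ : 0 ≤ ρ) (hs : 0 ≤ s)
    (hτ : 0 < τ) (n : ℕ) :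
    (2 : ℝ) ^ (⌊Real.logb 2 b * n⌋₊ + (n - 3 * ⌊Real.logb 2 b * n⌋₊)) * ((1 + s) / 2 / τ) ^ n ≤
        4 * ((1 + s) / (b ^ 2 * τ)) ^ n ∧
      2 ^ ⌊Real.logb 2 b * n⌋₊ * (((2 : ℝ) ^ (n - 3 * ⌊Real.logb 2 b * n⌋₊))⁻¹ * ρ ^ n) ≤
        (b ^ 4 * ρ / 2) ^ n := by
  have hb0 : 0 < b := zero_lt_one.trans hb
  set R := Real.logb 2 b with hR
  have hRpos : 0 < R := Real.logb_pos one_lt_two hb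
  have hbR : (2 : ℝ) ^ R = b := Real.rpow_logb two_pos (by norm_num) hb0
  set k := ⌊R * n⌋₊ with hk
  have hkle : (k : ℝ) ≤ R * n := Nat.floor_le (by positivity)
  have hklt : R * n < k + 1 := Nat.lt_floor_add_one _
  have hbn : (2 : ℝ) ^ (R * n) = b ^ n := by rw [Real.rpow_mul zero_le_two, hbR, Real.rpow_natCast]
  have hup : (2 : ℝ) ^ k ≤ b ^ n := by
    rw [← hbn, ← Real.rpow_natCast]
    exact Real.rpow_le_rpow_of_exponent_le one_le_two hkle
  -- Rounding down loses at most a factor 2, whose square is the 4 in the first bound.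
  have hlow : b ^ n ≤ 2 * 2 ^ k := by
    rw [← hbn, ← pow_succ', ← Real.rpow_natCast]
    exact Real.rpow_le_rpow_of_exponent_le one_le_two (by push_cast; exact hklt.le)
  have h3k : 3 * k ≤ n := by
    have : (2 : ℝ) ^ (3 * k) ≤ 2 ^ n := by
      calc (2 : ℝ) ^ (3 * k) = (2 ^ k) ^ 3 := by rw [mul_comm, pow_mul]
        _ ≤ (b ^ n) ^ 3 := by gcongr
        _ = (b ^ 3) ^ n := by rw [← pow_mul, ← pow_mul, mul_comm]
        _ ≤ 2 ^ n := by
          gcongr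
          exact (pow_le_pow_right₀ hb.le (by norm_num : 3 ≤ 4)).trans hb4.le
    exact (pow_le_pow_iff_right₀ one_lt_two).1 this
  clear_value k
  -- Writing `n = 3 * k + j` removes the truncated subtraction.
  obtain ⟨j, rfl⟩ := Nat.exists_eq_add_of_le h3k
  rw [Nat.add_sub_cancel_left]
  constructor
  · rw [div_div, div_pow, div_pow, mul_pow, mul_pow, ← mul_div_assoc, ← mul_div_assoc,
      div_le_div_iff₀ (by positivity) (by positivity)]
    have h5 : (b ^ 2) ^ (3 * k + j) ≤ (2 * 2 ^ k) ^ 2 := by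
      rw [← pow_mul, mul_comm, pow_mul]
      gcongr
    calc (2 : ℝ) ^ (k + j) * (1 + s) ^ (3 * k + j) * ((b ^ 2) ^ (3 * k + j) * τ ^ (3 * k + j))
        ≤ (2 : ℝ) ^ (k + j) * (1 + s) ^ (3 * k + j) * ((2 * 2 ^ k) ^ 2 * τ ^ (3 * k + j)) := by
          gcongr
      _ = _ := by ring
  · rw [div_pow, mul_pow, le_div_iff₀ (by positivity)]
    have h5 : ((2 : ℝ) ^ k) ^ 4 ≤ (b ^ 4) ^ (3 * k + j) := by
      rw [← pow_mul b, mul_comm 4, pow_mul]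
      gcongr
    calc (2 : ℝ) ^ k * (((2 : ℝ) ^ j)⁻¹ * ρ ^ (3 * k + j)) * 2 ^ (3 * k + j)
        = (2 ^ k) ^ 4 * ρ ^ (3 * k + j) * (((2 : ℝ) ^ j)⁻¹ * 2 ^ j) := by ring
      _ = (2 ^ k) ^ 4 * ρ ^ (3 * k + j) := by rw [inv_mul_cancel₀ (by positivity), mul_one]
      _ ≤ _ := by gcongr

/-- A channel with two distinct extremal output distributions with a common output letter has a
positive achievable commitment rate. -/
lemma exists_achievable {X Z : Type*} [Finite X] [Fintype Z] (W : X → PMF Z) {e : ZMod 2 → X}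
    (he : outputDist W (e 0) ≠ outputDist W (e 1))
    (hext : ∀ b, outputDist W (e b) ∈ (outputPolytope W).extremePoints ℝ) {z₀ : Z}
    (hz₀ : ∀ b, outputDist W (e b) z₀ ≠ 0) {B : ℝ} (hB : 0 ≤ B) :
    ∃ R, 0 < R ∧ Achievable W B R := by
  have : Nonempty X := ⟨e 0⟩
  choose g c' hc' hg hmean hgap' using fun b => exists_exposing_function W (hext b)
  let p : ZMod 2 → Z → ℝ := fun b => outputDist W (e b)
  have hp : ∀ b z, 0 ≤ p b z := fun b z => outputDist_nonneg W _ z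
  have hsum : ∀ b, ∑ z, p b z = 1 := fun b => sum_outputDist W _
  obtain ⟨c, hc, hgap⟩ : ∃ c : ℝ, 0 < c ∧ ∀ b x, outputDist W x ≠ outputDist W (e b) →
      ∑ z, outputDist W x z * g b z ≤ -c := by
    refine ⟨min (c' 0) (c' 1), lt_min (hc' 0) (hc' 1), fun b x hx => (hgap' b x hx).trans ?_⟩
    have : ∀ b : ZMod 2, b = 0 ∨ b = 1 := by decide
    rcases this b with rfl | rfl
    · exact neg_le_neg (min_le_left _ _)
    · exact neg_le_neg (min_le_right _ _)
  have hspread0 : 0 ≤ spread p := Finset.sum_nonneg fun z _ =>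
    div_nonneg (add_nonneg (sq_nonneg _) (sq_nonneg _)) (add_nonneg (hp _ _) (hp _ _))
  obtain ⟨b, hb, hb4, hbρ⟩ := exists_base (spread_lt_two hp hsum (hz₀ 0) (hz₀ 1))
  have hb0 : 0 < b := zero_lt_one.trans hb
  have hb2 : b < 2 := (le_self_pow₀ hb.le (by norm_num : (4 : ℕ) ≠ 0)).trans_lt hb4
  -- This makes `1 + s = b`, so the distance penalty has base `1 / (b * τ)`, below one exactly when
  -- `τ > b⁻¹`. Since `0 < s < 1`, a `τ < 1` equals `s ^ σ` with `σ > 0`, the relative distance.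
  set s := b - 1 with hs
  have hs0 : 0 < s := sub_pos.2 hb
  have hs1 : s < 1 := by linarith
  obtain ⟨τ, hτb, hτ1⟩ := exists_between (inv_lt_one_of_one_lt₀ hb)
  have hτ0 : 0 < τ := (inv_pos.2 hb0).trans hτb
  set σ := Real.logb s τ with hσdef
  have hσ : 0 < σ := Real.logb_pos_of_base_lt_one hs0 hs1 hτ0 hτ1
  obtain ⟨r, hr, hr1⟩ := exists_between (show b ^ 4 * spread p / 2 < 1 by linarith)
  have hr0 : 0 < r := lt_of_le_of_lt (by positivity) hr
  have hq : (1 + s) / (b ^ 2 * τ) < 1 := by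
    rw [div_lt_one (by positivity), hs]
    have : 1 < b * τ := by
      rwa [inv_lt_iff_one_lt_mul₀' hb0] at hτb
    nlinarith
  set R := Real.logb 2 b with hR
  have hRpos : 0 < R := Real.logb_pos one_lt_two hb
  refine ⟨R, hRpos, achievable_of_eventually W hB (fun n => (⌊R * n⌋₊ : ℝ) / n)
    (fun n => √(4 * r ^ n)) (fun n => Real.exp (-(min 1 (c * σ / 8) * (c * σ / 8)) * n)) ?_
    ?_ ?_ ?_⟩
  · have hE : ∀ᶠ n : ℕ in atTop, 4 * ((1 + s) / (b ^ 2 * τ)) ^ n < 1 / 2 := by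
      have := (tendsto_pow_atTop_nhds_zero_of_lt_one (by positivity) hq).const_mul 4
      rw [mul_zero] at this
      exact this.eventually_lt_const (by norm_num)
    filter_upwards [hE] with n hn
    obtain ⟨h1, h2⟩ := averaging_bound_le hb hb4 hspread0 hs0.le hτ0 n
    have h3 : 2 ^ ⌊R * n⌋₊ * (((2 : ℝ) ^ (n - 3 * ⌊R * n⌋₊))⁻¹ * spread p ^ n) / (4 * r ^ n) ≤
        1 / 4 := by
      rw [div_le_iff₀ (by positivity)]
      refine h2.trans ?_
      have : (b ^ 4 * spread p / 2) ^ n ≤ r ^ n := by gcongr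
      linarith
    obtain ⟨y, hy1, hy2⟩ := exists_code hp hsum hs0 hτ0 (by positivity : 0 < 4 * r ^ n)
      ((add_le_add (h1.trans hn.le) h3).trans_lt (by norm_num))
    refine ⟨_, codeProtocol_messageBound _ _ hB, codeProtocol_concealing _ _ W (mixture p) hy2,
      codeProtocol_binding W he hc hσ hg hmean hgap y ?_, ?_⟩
    · intro a a' m m' ha
      have h4 := hy1 a a' m m' ha
      have h5 : τ ^ n = s ^ (σ * n) := by
        rw [Real.rpow_mul hs0.le, Real.rpow_logb hs0 hs1.ne hτ0, Real.rpow_natCast]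
      rw [h5, ← Real.rpow_natCast] at h4
      exact ((Real.rpow_lt_rpow_left_iff_of_base_lt_one hs0 hs1).1 h4).le
    · rw [codeProtocol_rate]
      simp [Real.logb_pow, hR]
  · exact (tendsto_nat_floor_mul_div_atTop hRpos.le).comp tendsto_natCast_atTop_atTop
  · have := ((tendsto_pow_atTop_nhds_zero_of_lt_one hr0.le hr1).const_mul 4).sqrt
    simpa using this
  · have hκ : 0 < min 1 (c * σ / 8) * (c * σ / 8) := by positivity
    refine Real.tendsto_exp_atBot.comp ?_
    exact tendsto_natCast_atTop_atTop.const_mul_atTop_of_neg (neg_neg_of_pos hκ)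

end BitCommitment

end

theorem corollary1 {X Z : Type*} [Fintype X] [Fintype Z] (W : X → PMF Z)
    (hW : ¬ BitCommitment.IsTrivial W) (B : ℝ) (hB : 0 ≤ B) :
    0 < BitCommitment.commitmentCapacity W B := by
  simp only [BitCommitment.IsTrivial, not_forall] at hW
  obtain ⟨p, hp, q, hq, hpq, hdisj⟩ := hW
  obtain ⟨z₀, hz₀p, hz₀q⟩ := Set.not_disjoint_iff.1 hdisj
  -- Extreme points of a hull belong to the generating set, so they are output distributions of
  -- actual inputs.
  obtain ⟨x, rfl⟩ := extremePoints_convexHull_subset hp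
  obtain ⟨x', rfl⟩ := extremePoints_convexHull_subset hq
  obtain ⟨R, hR, hach⟩ := BitCommitment.exists_achievable W
    (e := fun b : ZMod 2 => if b = 0 then x else x') (by simpa using hpq)
    (fun b => by by_cases hb : b = 0 <;> simp [hb, hp, hq]) (z₀ := z₀)
    (fun b => by by_cases hb : b = 0 <;> simpa [hb] using ‹_›) hB
  exact lt_of_lt_of_le (EReal.coe_pos.2 hR) (le_sSup ⟨R, hach, rfl⟩)
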